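/- Let $T$ be a complete first-order theory in a language $L$, and suppose that $T$ is small, i.e. that $T$ has only countably many complete types without parameters in finitely many variables ($S_n(T)$ is countable for every $n\in\mathbb N$). Let $\mathcal C\models T$ be $\kappa$-saturated for some infinite cardinal $\kappa$ (for instance, the monster model of $T$), let $A\subseteq\mathcal C$ be a finite set, and let $n\in\mathbb N$. Let $E$ be an equivalence relation on $\mathcal C^n$ that is type-definable ($\infty$-definable) over $A$, i.e. there is a (possibly infinite) set $\Phi(\bar x,\bar y)$ of $L$-formulas with parameters from $A$ such that, for all $\bar a,\bar b\in\mathcal C^n$, $E(\bar a,\bar b)$ holds if and only if $\mathcal C\models\varphi(\bar a,\bar b)$ for all $\varphi\in\Phi$. Then $E$ is equivalent to a conjunction of definable equivalence relations over $A$: there is a family $(E_i)_{i\in I}$ of equivalence relations on $\mathcal C^n$, each defined by a single $L$-formula with parameters from $A$, such that for all $\bar a,\bar b\in\mathcal C^n$, $$E(\bar a,\bar b)\iff E_i(\bar a,\bar b)\ \text{ for all } i\in I .$$ -/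

import Mathlib

open FirstOrder Cardinal

universe u v w

namespace FirstOrder.Language

/-- A theory is small if it has only countably many complete types (without parameters)
in finitely many variables. -/
def Theory.IsSmall {L : Language.{u, v}} (T : L.Theory) : Prop :=
  ∀ n : ℕ, Countable (T.CompleteType (Fin n))

/-- `M` is `κ`-saturated: for every set `B` of fewer than `κ` parameters from `M`, every set of
formulas over `B` in finitely many free variables that is finitely satisfiable in `M`
is realized in `M`. -/
def IsSaturated (L : Language.{u, v}) (κ : Cardinal.{w}) (M : Type w) [L.Structure M] : Prop :=
  ∀ (B : Set M), #B < κ → ∀ (m : ℕ) (p : Set (L[[B]].Formula (Fin m))),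
    (∀ q : Set (L[[B]].Formula (Fin m)), q ⊆ p → q.Finite →
      ∃ c : Fin m → M, ∀ φ ∈ q, φ.Realize c) →
    ∃ c : Fin m → M, ∀ φ ∈ p, φ.Realize c

/-- An equivalence relation on `n`-tuples, viewed as a set of tuples in the `2n` variables
`(x, y)`. -/
def tupleGraph {M : Type w} {n : ℕ} (E : Setoid (Fin n → M)) : Set (Fin n ⊕ Fin n → M) :=
  {c | E (fun i => c (Sum.inl i)) (fun i => c (Sum.inr i))}

/-- The equivalence relation `E` is definable over `A`: it is given by one formula `φ(x, y)` with
parameters from `A`. -/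
def DefinableOver (L : Language.{u, v}) {M : Type w} [L.Structure M] (A : Set M) {n : ℕ}
    (E : Setoid (Fin n → M)) : Prop :=
  A.Definable L (tupleGraph E)

/-- The equivalence relation `E` is type-definable (`∞`-definable) over `A`: it is given by the
conjunction of a (possibly infinite) set of formulas `φ(x, y)` with parameters from `A`. -/
def TypeDefinableOver (L : Language.{u, v}) {M : Type w} [L.Structure M] (A : Set M) {n : ℕ}
    (E : Setoid (Fin n → M)) : Prop :=
  ∃ Φ : Set (L[[A]].Formula (Fin n ⊕ Fin n)), tupleGraph E = {c | ∀ φ ∈ Φ, φ.Realize c}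

end FirstOrder.Language

namespace FirstOrder.Language

open Set Topology TopologicalSpace

/-! Give tuples the topology generated by the `A`-definable sets. Saturation makes it compact and
makes projections closed maps, so the quotient of pairs by `E` in each coordinate is normal. For a
pair outside `E`, Urysohn's lemma gives a continuous `E`-invariant real function that is 0 on `E`
and 1 at the pair. By smallness it has countably many values, so cutting at an omitted value in (0,
1) gives a clopen, hence definable, `E`-invariant relation `R` (`exists_definable_separating`).
Having equal `R`-fibres is then a definable equivalence relation coarser than `E` that separates the
pair. -/

/-- The image of a normal space under a continuous closed surjection is normal. -/
theorem normalSpace_of_isClosedMap {X Y : Type*} [TopologicalSpace X] [TopologicalSpace Y]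
    [NormalSpace X] {f : X → Y} (hf : Continuous f) (hc : IsClosedMap f)
    (hs : Function.Surjective f) : NormalSpace Y where
  normal s t hsc htc hst := by
    obtain ⟨u, v, hu, hv, hsu, htv, huv⟩ := normal_separation (hsc.preimage hf) (htc.preimage hf)
      (hst.preimage f)
    refine ⟨(f '' uᶜ)ᶜ, (f '' vᶜ)ᶜ, (hc _ hu.isClosed_compl).isOpen_compl,
      (hc _ hv.isClosed_compl).isOpen_compl, ?_, ?_, ?_⟩
    · rintro _ hy ⟨x, hx, rfl⟩
      exact hx (hsu hy)
    · rintro _ hy ⟨x, hx, rfl⟩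
      exact hx (htv hy)
    · rw [Set.disjoint_left]
      intro y hyu hyv
      obtain ⟨x, rfl⟩ := hs y
      have hxu : x ∈ u := by_contra fun h => hyu ⟨x, h, rfl⟩
      have hxv : x ∈ v := by_contra fun h => hyv ⟨x, h, rfl⟩
      exact Set.disjoint_left.1 huv hxu hxv

variable {L : Language.{u, v}} {M : Type w} [L.Structure M] {A : Set M}

/-- In a saturated structure, an intersection-closed family of nonempty sets of finite tuples that
are definable over a fixed finite set has a common point. -/
theorem IsSaturated.nonempty_sInter {κ : Cardinal.{w}} (hM : L.IsSaturated κ M) (hκ : ℵ₀ ≤ κ)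
    (hA : A.Finite) {α : Type*} [Finite α] {S : Set (Set (α → M))} (hS : S.Nonempty)
    (hdef : ∀ s ∈ S, A.Definable L s) (hne : ∀ s ∈ S, s.Nonempty)
    (hinter : ∀ s ∈ S, ∀ t ∈ S, s ∩ t ∈ S) : (⋂₀ S).Nonempty := by
  obtain ⟨m, ⟨e⟩⟩ := Finite.exists_equiv_fin α
  obtain ⟨c, hc⟩ := hM A (hA.lt_aleph0.trans_le hκ) m
    {φ | {x : α → M | φ.Realize (x ∘ e.symm)} ∈ S} (fun q hq hfin => by
      have key : ∃ s ∈ S, ∀ φ ∈ q, s ⊆ {x : α → M | φ.Realize (x ∘ e.symm)} := by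
        induction q, hfin using Set.Finite.induction_on with
        | empty => exact ⟨hS.some, hS.some_mem, by simp⟩
        | @insert φ q _ _ ih =>
          obtain ⟨s, hs, hsq⟩ := ih fun ψ hψ => hq (mem_insert_of_mem _ hψ)
          refine ⟨_, hinter _ (hq (mem_insert φ q)) s hs, ?_⟩
          rintro ψ (rfl | hψ)
          · exact inter_subset_left
          · exact inter_subset_right.trans (hsq ψ hψ)
      obtain ⟨s, hs, hsq⟩ := key
      obtain ⟨x, hx⟩ := hne s hs
      exact ⟨x ∘ e.symm, fun φ hφ => hsq φ hφ hx⟩)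
  refine ⟨c ∘ e, fun s hs => ?_⟩
  obtain ⟨φ, rfl⟩ := hdef s hs
  have h := hc (φ.relabel e) (by
    rw [mem_ofPred_eq]
    convert hs using 1
    ext x
    simp [Formula.realize_relabel, Function.comp_def])
  simpa [Formula.realize_relabel] using h

/-- Substituting a tuple for some of the variables of a set definable over `A` gives a set definable
over `A` and the tuple. -/
theorem definable_slice {α β : Type*} {s : Set (α ⊕ β → M)} (hs : A.Definable L s) (y : β → M) :
    (A ∪ range y).Definable L {x : α → M | Sum.elim x y ∈ s} := by
  rw [Set.definable_iff_exists_formula_sum] at hs ⊢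
  obtain ⟨φ, rfl⟩ := hs
  refine ⟨φ.relabel (Sum.elim (fun a : A => Sum.inl ⟨a.1, Or.inl a.2⟩)
    (Sum.elim Sum.inr fun b => Sum.inl ⟨y b, Or.inr ⟨b, rfl⟩⟩)), ?_⟩
  ext x
  simp only [mem_ofPred_eq, Formula.realize_relabel]
  refine iff_of_eq (congrArg _ ?_)
  funext i
  rcases i with a | a | b <;> rfl

/-! ### The topology of definable sets -/

variable (L A) in
/-- The topology on tuples whose basic open sets are the sets definable over `A`. -/
@[reducible]
def definableTopology (α : Type*) : TopologicalSpace (α → M) :=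
  generateFrom {s | A.Definable L s}

theorem isTopologicalBasis_definable (α : Type*) :
    @IsTopologicalBasis _ (definableTopology L A α) {s : Set (α → M) | A.Definable L s} := by
  let := definableTopology L A α
  have h := isTopologicalBasis_of_subbasis_of_inter (t := definableTopology L A α)
    (r := {s : Set (α → M) | A.Definable L s}) rfl fun s hs t ht => hs.inter ht
  rwa [insert_eq_of_mem (show Set.univ ∈ {s : Set (α → M) | A.Definable L s} from
    definable_univ)] at h

theorem Definable.isClosed {α : Type*} {s : Set (α → M)} (hs : A.Definable L s) :
    IsClosed[definableTopology L A α] s := by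
  let := definableTopology L A α
  exact ⟨isOpen_generateFrom_of_mem hs.compl⟩

theorem continuous_comp_definableTopology {α β : Type*} (f : α → β) :
    @Continuous _ _ (definableTopology L A β) (definableTopology L A α)
      (fun x : β → M => x ∘ f) := by
  let := definableTopology L A β
  exact continuous_generateFrom_iff.2 fun s hs =>
    isOpen_generateFrom_of_mem (Set.Definable.preimage_comp f hs)

/-- Tuples with the same type over `A` are inseparable, so the space is not Hausdorff in general; R1
with compactness still yields normality. -/
theorem r1Space_definableTopology (α : Type*) :
    @R1Space (α → M) (definableTopology L A α) := by
  let := definableTopology L A α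
  refine ⟨fun x y => ?_⟩
  by_cases h : ∀ s : Set (α → M), A.Definable L s → y ∈ s → x ∈ s
  · left
    rw [specializes_iff_forall_open]
    intro U hU hy
    obtain ⟨s, hs, hys, hsU⟩ := (isTopologicalBasis_definable α).exists_subset_of_mem_open hy hU
    exact hsU (h s hs hys)
  · right
    push Not at h
    obtain ⟨s, hs, hys, hxs⟩ := h
    exact Filter.disjoint_of_disjoint_of_mem disjoint_compl_left
      ((Definable.isClosed hs).isOpen_compl.mem_nhds hxs)
      ((isOpen_generateFrom_of_mem (show s ∈ {s | A.Definable L s} from hs)).mem_nhds hys)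

theorem exists_definable_notMem {α : Type*} {s : Set (α → M)}
    (hs : IsClosed[definableTopology L A α] s) {x : α → M} (hx : x ∉ s) :
    ∃ t, A.Definable L t ∧ s ⊆ t ∧ x ∉ t := by
  let := definableTopology L A α
  obtain ⟨t, ht, hxt, hts⟩ := (isTopologicalBasis_definable α).exists_subset_of_mem_open
    (show x ∈ sᶜ from hx) hs.isOpen_compl
  exact ⟨tᶜ, ht.compl, subset_compl_comm.1 hts, fun h => h hxt⟩

theorem IsSaturated.compactSpace {κ : Cardinal.{w}} (hM : L.IsSaturated κ M) (hκ : ℵ₀ ≤ κ)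
    (hA : A.Finite) (α : Type*) [Finite α] :
    @CompactSpace (α → M) (definableTopology L A α) := by
  let := definableTopology L A α
  refine ⟨isCompact_iff_ultrafilter_le_nhds.2 fun F _ => ?_⟩
  obtain ⟨c, hc⟩ := hM.nonempty_sInter hκ hA (S := {s | A.Definable L s ∧ s ∈ F})
    ⟨Set.univ, definable_univ, Filter.univ_mem⟩ (fun s hs => hs.1)
    (fun s hs => F.nonempty_of_mem hs.2)
    (fun s hs t ht => ⟨hs.1.inter ht.1, Filter.inter_mem hs.2 ht.2⟩)
  refine ⟨c, mem_univ _, ?_⟩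
  intro U hU
  obtain ⟨s, hs, hcs, hsU⟩ := (isTopologicalBasis_definable α).mem_nhds_iff.1 hU
  refine F.mem_of_superset ?_ hsU
  by_contra h
  exact hc sᶜ ⟨hs.compl, Ultrafilter.compl_mem_iff_notMem.2 h⟩ hcs

/-- In a saturated structure, projections are closed maps. -/
theorem IsSaturated.isClosedMap_comp_inr {κ : Cardinal.{w}} (hM : L.IsSaturated κ M)
    (hκ : ℵ₀ ≤ κ) (hA : A.Finite) (α β : Type*) [Finite α] [Finite β] :
    @IsClosedMap _ _ (definableTopology L A (α ⊕ β)) (definableTopology L A β)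
      (fun z : α ⊕ β → M => z ∘ Sum.inr) := by
  let := definableTopology L A (α ⊕ β)
  let := definableTopology L A β
  intro K hK
  rw [← isOpen_compl_iff, (isTopologicalBasis_definable β).isOpen_iff]
  intro y hy
  by_contra! hcon
  obtain ⟨x, hx⟩ := hM.nonempty_sInter hκ (hA.union (finite_range y)) (α := α)
    (S := {s | ∃ t : Set (α ⊕ β → M), A.Definable L t ∧ K ⊆ t ∧ s = {x | Sum.elim x y ∈ t}})
    ⟨_, Set.univ, definable_univ, subset_univ _, rfl⟩
    (by rintro _ ⟨t, ht, -, rfl⟩; exact definable_slice ht y)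
    (by
      rintro _ ⟨t, ht, hKt, rfl⟩
      by_contra hne
      rw [not_nonempty_iff_eq_empty] at hne
      -- If the slice of `t` at `y` is empty, the complement of the projection of `t` is a definable
      -- neighbourhood of `y` missing the projection of `K`.
      refine hcon _ (ht.image_comp (Sum.inr : β → α ⊕ β)).compl ?_
        (compl_subset_compl.2 (image_mono hKt))
      rintro ⟨z, hz, rfl⟩
      refine (Set.ext_iff.1 hne (z ∘ Sum.inl)).1 ?_
      rwa [mem_ofPred_eq, Sum.elim_comp_inl_inr])
    (by
      rintro _ ⟨t, ht, hKt, rfl⟩ _ ⟨t', ht', hKt', rfl⟩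
      exact ⟨t ∩ t', ht.inter ht', subset_inter hKt hKt', rfl⟩)
  refine hy ⟨Sum.elim x y, ?_, rfl⟩
  by_contra hxK
  obtain ⟨t, ht, hKt, hxt⟩ := exists_definable_notMem hK hxK
  exact hxt (hx _ ⟨t, ht, hKt, rfl⟩)

theorem IsSaturated.definable_of_isClopen {κ : Cardinal.{w}} (hM : L.IsSaturated κ M)
    (hκ : ℵ₀ ≤ κ) (hA : A.Finite) {α : Type*} [Finite α] {s : Set (α → M)}
    (hs : @IsClopen _ (definableTopology L A α) s) : A.Definable L s := by
  let := definableTopology L A α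
  have := hM.compactSpace hκ hA α
  obtain ⟨t, ht, hst, hts⟩ : ∃ t, A.Definable L t ∧ s ⊆ t ∧ t ⊆ s := by
    refine hs.1.isCompact.induction_on (p := fun u => ∃ t, A.Definable L t ∧ u ⊆ t ∧ t ⊆ s)
      ⟨∅, definable_empty, subset_rfl, empty_subset _⟩ ?_ ?_ ?_
    · rintro u u' huu' ⟨t, ht, hut, hts⟩
      exact ⟨t, ht, huu'.trans hut, hts⟩
    · rintro u u' ⟨t, ht, hut, hts⟩ ⟨t', ht', hut', hts'⟩
      exact ⟨t ∪ t', ht.union ht', union_subset_union hut hut', union_subset hts hts'⟩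
    · intro x hx
      obtain ⟨t, ht, hxt, hts⟩ :=
        (isTopologicalBasis_definable α).exists_subset_of_mem_open hx hs.2
      exact ⟨t, mem_nhdsWithin_of_mem_nhds ((isOpen_generateFrom_of_mem ht).mem_nhds hxt),
        t, ht, subset_rfl, hts⟩
  rwa [hst.antisymm hts]

/-- Over a small theory, a continuous function on finite tuples, for the topology of sets definable
over a finite set, takes only countably many values. -/
theorem Theory.IsSmall.countable_range {T : L.Theory} (hT : T.IsSmall) [Nonempty M] [M ⊨ T]
    (hA : A.Finite) {α : Type*} [Finite α] {Z : Type*} [TopologicalSpace Z] [T0Space Z]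
    {g : (α → M) → Z} (hg : @Continuous _ _ (definableTopology L A α) _ g) :
    (range g).Countable := by
  let := definableTopology L A α
  have : Finite A := hA
  obtain ⟨N, ⟨e⟩⟩ := Finite.exists_equiv_fin (A ⊕ α)
  have := hT N
  -- The finitely many parameters become extra variables, so parameter-free types suffice.
  let τ : (α → M) → T.CompleteType (Fin N) := fun x => T.typeOf (Sum.elim (↑) x ∘ e.symm)
  have hτ : ∀ x y, τ x = τ y → g x = g y := by
    intro x y hxy
    refine Inseparable.eq (Inseparable.map ?_ hg)
    have key : ∀ s, A.Definable L s → (x ∈ s ↔ y ∈ s) := by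
      intro s hs
      obtain ⟨φ, rfl⟩ := Set.definable_iff_exists_formula_sum.1 hs
      have h : ∀ z : α → M, Formula.equivSentence (φ.relabel e) ∈ τ z ↔
          φ.Realize (Sum.elim (↑) z) := fun z => by
        rw [Theory.CompleteType.formula_mem_typeOf, Formula.realize_relabel, Function.comp_assoc,
          _root_.Equiv.symm_comp_self, Function.comp_id]
      rw [mem_ofPred_eq, mem_ofPred_eq, ← h, ← h, hxy]
    rw [inseparable_iff_forall_isOpen]
    have half : ∀ x y : α → M, (∀ s, A.Definable L s → (x ∈ s ↔ y ∈ s)) →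
        ∀ U : Set (α → M), IsOpen U → x ∈ U → y ∈ U := by
      intro x y key U hU hx
      obtain ⟨s, hs, hxs, hsU⟩ :=
        (isTopologicalBasis_definable α).exists_subset_of_mem_open hx hU
      exact hsU ((key s hs).1 hxs)
    exact fun U hU => ⟨half x y key U hU, half y x (fun s hs => (key s hs).symm) U hU⟩
  have hfac : g = (fun p : range τ => g p.2.choose) ∘ rangeFactorization τ := by
    funext x
    exact hτ _ _ (rangeFactorization τ x).2.choose_spec.symm
  rw [hfac]
  exact (Set.countable_range _).mono (range_comp_subset_range _ _)

theorem TypeDefinableOver.isClosed {n : ℕ} {E : Setoid (Fin n → M)}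
    (hE : L.TypeDefinableOver A E) :
    IsClosed[definableTopology L A (Fin n ⊕ Fin n)] (tupleGraph E) := by
  let := definableTopology L A (M := M) (Fin n ⊕ Fin n)
  obtain ⟨Φ, hΦ⟩ := hE
  have : tupleGraph E = ⋂ φ ∈ Φ, {c | φ.Realize c} := by
    rw [hΦ]
    ext c
    simp
  rw [this]
  exact isClosed_biInter fun φ _ => Definable.isClosed ⟨φ, rfl⟩

/-! ### The quotient by `E` and separation -/

/-- Two pairs of tuples are equivalent if they are so coordinatewise. -/
def pairSetoid {n : ℕ} (E : Setoid (Fin n → M)) : Setoid (Fin n ⊕ Fin n → M) where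
  r c d := E (c ∘ Sum.inl) (d ∘ Sum.inl) ∧ E (c ∘ Sum.inr) (d ∘ Sum.inr)
  iseqv := ⟨fun _ => ⟨E.refl _, E.refl _⟩, fun h => ⟨E.symm h.1, E.symm h.2⟩,
    fun h h' => ⟨E.trans h.1 h'.1, E.trans h.2 h'.2⟩⟩

/-- The saturation of a closed `K` under the relation is the projection of a closed set of pairs. -/
theorem IsSaturated.isClosedMap_mk_pairSetoid {κ : Cardinal.{w}} (hM : L.IsSaturated κ M)
    (hκ : ℵ₀ ≤ κ) (hA : A.Finite) {n : ℕ} {E : Setoid (Fin n → M)}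
    (hE : L.TypeDefinableOver A E) :
    letI := definableTopology L A (M := M) (Fin n ⊕ Fin n)
    IsClosedMap (Quotient.mk (pairSetoid E)) := by
  let := definableTopology L A (M := M) (Fin n ⊕ Fin n)
  let := definableTopology L A (M := M) ((Fin n ⊕ Fin n) ⊕ (Fin n ⊕ Fin n))
  intro K hK
  rw [← isQuotientMap_quotient_mk'.isClosed_preimage]
  have hcl : IsClosed {z : (Fin n ⊕ Fin n) ⊕ (Fin n ⊕ Fin n) → M |
      z ∘ Sum.inl ∈ K ∧ pairSetoid E (z ∘ Sum.inl) (z ∘ Sum.inr)} := by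
    refine (hK.preimage (continuous_comp_definableTopology Sum.inl)).inter
      ((hE.isClosed.preimage (continuous_comp_definableTopology
          (Sum.elim (Sum.inl ∘ Sum.inl) (Sum.inr ∘ Sum.inl)))).inter
        (hE.isClosed.preimage (continuous_comp_definableTopology
          (Sum.elim (Sum.inl ∘ Sum.inr) (Sum.inr ∘ Sum.inr)))))
  convert hM.isClosedMap_comp_inr hκ hA _ _ _ hcl using 1
  ext y
  constructor
  · rintro ⟨x, hx, hxy⟩
    exact ⟨Sum.elim x y, ⟨hx, Quotient.exact hxy⟩, rfl⟩
  · rintro ⟨z, ⟨hz, hzy⟩, rfl⟩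
    exact ⟨_, hz, Quotient.sound hzy⟩

/-- Pairs outside a type-definable equivalence relation `E` over a finite set are separated from it
by a definable relation invariant under `E`. -/
theorem IsSaturated.exists_definable_separating {κ : Cardinal.{w}} (hM : L.IsSaturated κ M)
    (hκ : ℵ₀ ≤ κ) {T : L.Theory} (hT : T.IsSmall) [Nonempty M] [M ⊨ T]
    (hA : A.Finite) {n : ℕ} {E : Setoid (Fin n → M)}
    (hE : L.TypeDefinableOver A E) {c : Fin n ⊕ Fin n → M} (hc : c ∉ tupleGraph E) :
    ∃ R : Set (Fin n ⊕ Fin n → M), A.Definable L R ∧ tupleGraph E ⊆ R ∧ c ∉ R ∧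
      ∀ d d', pairSetoid E d d' → (d ∈ R ↔ d' ∈ R) := by
  let := definableTopology L A (M := M) (Fin n ⊕ Fin n)
  have := hM.compactSpace hκ hA (Fin n ⊕ Fin n)
  have := r1Space_definableTopology (L := L) (A := A) (Fin n ⊕ Fin n)
  have hmk : Continuous (Quotient.mk (pairSetoid E)) := continuous_quotient_mk'
  have hclosed := hM.isClosedMap_mk_pairSetoid hκ hA hE
  have := normalSpace_of_isClosedMap hmk hclosed Quotient.mk_surjective
  obtain ⟨D, hD, hED, hcD⟩ := exists_definable_notMem hE.isClosed hc
  have hdisj : Disjoint (Quotient.mk (pairSetoid E) '' tupleGraph E)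
      (Quotient.mk (pairSetoid E) '' Dᶜ) := by
    rw [Set.disjoint_left]
    rintro _ ⟨d, hd, rfl⟩ ⟨d', hd', h⟩
    have h := Quotient.exact h
    exact hd' (hED (E.trans h.1 (E.trans hd (E.symm h.2))))
  obtain ⟨f, hf0, hf1, -⟩ := exists_continuous_zero_one_of_isClosed
    (hclosed _ hE.isClosed) (hclosed _ (Definable.isClosed hD.compl)) hdisj
  have hg : Continuous (f ∘ Quotient.mk (pairSetoid E)) := f.continuous.comp hmk
  obtain ⟨r, ⟨hr0, hr1⟩, hr⟩ :
      (Ioo (0 : ℝ) 1 \ range (f ∘ Quotient.mk (pairSetoid E))).Nonempty := by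
    rw [nonempty_iff_ne_empty, Ne, sdiff_eq_empty]
    intro h
    have hcount := (hT.countable_range hA hg).mono h
    rw [← Cardinal.le_aleph0_iff_set_countable, Cardinal.mk_Ioo_real one_pos] at hcount
    exact hcount.not_gt Cardinal.aleph0_lt_continuum
  -- As `r` is not a value, `< r` and `≤ r` cut out the same set, which is therefore clopen.
  refine ⟨{d | f (Quotient.mk _ d) < r}, hM.definable_of_isClopen hκ hA ⟨?_, ?_⟩, ?_, ?_, ?_⟩
  · convert isClosed_le hg continuous_const using 1
    ext d
    exact ⟨fun h => le_of_lt (show f _ < r from h),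
      fun h => lt_of_le_of_ne h fun he => hr ⟨d, he⟩⟩
  · exact isOpen_lt hg continuous_const
  · intro d hd
    simpa [hf0 ⟨d, hd, rfl⟩] using hr0
  · have := hf1 ⟨c, hcD, rfl⟩
    simpa [this] using hr1.le
  · intro d d' h
    rw [mem_ofPred_eq, mem_ofPred_eq, Quotient.sound h]

/-- Tuples are equivalent if they have the same fibre in the relation `R`. -/
def fibreSetoid {n : ℕ} (R : Set (Fin n ⊕ Fin n → M)) : Setoid (Fin n → M) where
  r x y := ∀ z : Fin n → M, Sum.elim x z ∈ R ↔ Sum.elim y z ∈ R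
  iseqv := ⟨fun _ _ => Iff.rfl, fun h z => (h z).symm, fun h h' z => (h z).trans (h' z)⟩

theorem definableOver_fibreSetoid {n : ℕ} {R : Set (Fin n ⊕ Fin n → M)}
    (hR : A.Definable L R) : L.DefinableOver A (fibreSetoid R) := by
  have h₁ := hR.preimage_comp
    (Sum.elim (Sum.inl ∘ Sum.inl) Sum.inr : Fin n ⊕ Fin n → (Fin n ⊕ Fin n) ⊕ Fin n)
  have h₂ := hR.preimage_comp
    (Sum.elim (Sum.inl ∘ Sum.inr) Sum.inr : Fin n ⊕ Fin n → (Fin n ⊕ Fin n) ⊕ Fin n)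
  have h := ((h₁.inter h₂).union (h₁.compl.inter h₂.compl)).forall_of_finite
  rw [DefinableOver]
  convert h using 1
  ext c
  refine forall_congr' fun z => iff_iff_and_or_not_and_not.trans ?_
  have hl : Sum.elim c z ∘ Sum.elim (Sum.inl ∘ Sum.inl) Sum.inr =
      Sum.elim (fun i => c (Sum.inl i)) z := by
    ext i; cases i <;> rfl
  have hr : Sum.elim c z ∘ Sum.elim (Sum.inl ∘ Sum.inr) Sum.inr =
      Sum.elim (fun i => c (Sum.inr i)) z := by
    ext i; cases i <;> rfl
  simp only [mem_union, mem_inter_iff, mem_compl_iff, mem_preimage, hl, hr]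

end FirstOrder.Language

theorem theorem22 {L : FirstOrder.Language.{u, v}} (T : L.Theory) (hT : T.IsComplete) (hsmall : T.IsSmall)
    {C : Type w} [L.Structure C] [Nonempty C] [C ⊨ T]
    (κ : Cardinal.{w}) (hκ : ℵ₀ ≤ κ) (hC : L.IsSaturated κ C)
    (A : Set C) (hA : A.Finite) (n : ℕ)
    (E : Setoid (Fin n → C)) (hE : L.TypeDefinableOver A E) :
    ∃ S : Set (Setoid (Fin n → C)),
      (∀ F ∈ S, L.DefinableOver A F) ∧
      ∀ a b : Fin n → C, E a b ↔ ∀ F ∈ S, F a b := by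
  refine ⟨{F | L.DefinableOver A F ∧ ∀ a b, E a b → F a b}, fun F hF => hF.1, fun a b =>
    ⟨fun h F hF => hF.2 a b h, fun h => ?_⟩⟩
  by_contra hab
  obtain ⟨R, hR, hER, habR, hinv⟩ := hC.exists_definable_separating hκ hsmall hA hE
    (c := Sum.elim a b) hab
  -- Compare fibres at `b`: `(b, b)` lies in `R` but `(a, b)` does not.
  refine habR ((h (FirstOrder.Language.fibreSetoid R)
    ⟨FirstOrder.Language.definableOver_fibreSetoid hR, fun x y hxy z => ?_⟩ b).2 ?_)
  · exact hinv _ _ ⟨hxy, E.refl _⟩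
  · exact hER (E.refl b)
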